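/- Let $V$ be a free $\mathbb{Z}$-module of finite rank $n$ endowed with a quadratic form $q$, and put $\beta_q(x,y)=q(x+y)-q(x)-q(y)$. Assume that $q$ is regular, i.e. either $\beta_q$ is a perfect pairing on $V$, or $n$ is odd and the half-discriminant of $q$ (half of the determinant of a Gram matrix of $\beta_q$) is $\pm 1$. Let $P(X)=(X-1)^a(X+1)^{2b}Q(X)$, with integers $a,b\ge 0$, be a monic polynomial of degree $n$ in $\mathbb{Q}[X]$ such that $Q(1)Q(-1)\neq 0$. For a prime $p$, let $\mathrm{SO}(V,q)(\mathbb{Z}_p)$ be the group of $\mathbb{Z}_p$-linear automorphisms of $\mathbb{Z}_p\otimes_{\mathbb{Z}} V$ of determinant $1$ that preserve the quadratic form deduced from $q$ by extension of scalars. Assume that for every prime $p$ there exists $\gamma_p\in \mathrm{SO}(V,q)(\mathbb{Z}_p)$ with characteristic polynomial $P$. If $b=0$, then $|Q(-1)|$ is the square of an integer, and if $a=0$, then $|Q(1)|$ is the square of an integer. -/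

import Mathlib

open Polynomial
open scoped TensorProduct

noncomputable section

namespace QuadZ

/-- `q` is non-degenerate: the polar form `β_q(x, y) = q(x + y) - q(x) - q(y)` is a perfect
pairing on `V`. -/
def IsNondegenerate {R V : Type*} [CommRing R] [AddCommGroup V] [Module R V]
    (q : QuadraticForm R V) : Prop :=
  q.polarBilin.IsPerfPair

/-- `d` is the half-discriminant of the integral quadratic form `q` in the basis `b` (meaningful
in odd rank): the determinant of the Gram matrix of `β_q` equals `2 * d`. As `ℤ` has no
`2`-torsion this determines `d`; a change of basis does not change `d`. -/
def IsHalfDiscriminant {V : Type*} [AddCommGroup V] {n : ℕ}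
    (q : QuadraticForm ℤ V) (b : Module.Basis (Fin n) ℤ V) (d : ℤ) : Prop :=
  (LinearMap.BilinForm.toMatrix b q.polarBilin).det = 2 * d

/-- A quadratic form on a free `ℤ`-module of finite rank `n` is regular if it is non-degenerate,
or if `n` is odd and its half-discriminant is invertible. -/
def IsRegular {V : Type*} [AddCommGroup V] (q : QuadraticForm ℤ V) : Prop :=
  IsNondegenerate q ∨
    ∃ (n : ℕ) (b : Module.Basis (Fin n) ℤ V) (d : ℤ),
      Odd n ∧ IsHalfDiscriminant q b d ∧ IsUnit d

section BaseChange

variable {R V : Type*} [CommRing R] [AddCommGroup V] [Module R V] [Module.Free R V]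

/-- The extension of scalars of a quadratic form on a free module to an `R`-algebra `A`, where `2`
is not assumed to be invertible: write `q(x) = B(x, x)` and extend the bilinear form `B`. By
`baseChange_tmul` and `baseChange_unique` this is the usual base change, independent of `B`. -/
def baseChange (A : Type*) [CommRing A] [Algebra R A] (q : QuadraticForm R V) :
    QuadraticForm A (A ⊗[R] V) :=
  LinearMap.BilinMap.toQuadraticMap
    (LinearMap.BilinForm.baseChange A
      (Classical.choose (LinearMap.BilinMap.toQuadraticMap_surjective q)))

theorem baseChange_tmul (A : Type*) [CommRing A] [Algebra R A] (q : QuadraticForm R V)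
    (a : A) (v : V) : baseChange A q (a ⊗ₜ[R] v) = q v • (a * a) := by
  have h := Classical.choose_spec (LinearMap.BilinMap.toQuadraticMap_surjective q)
  rw [baseChange, LinearMap.BilinMap.toQuadraticMap_apply,
    LinearMap.BilinForm.baseChange_tmul, ← LinearMap.BilinMap.toQuadraticMap_apply, h]

theorem baseChange_unique (A : Type*) [CommRing A] [Algebra R A] (q : QuadraticForm R V)
    (q' : QuadraticForm A (A ⊗[R] V)) (h : ∀ v, q' (1 ⊗ₜ[R] v) = algebraMap R A (q v)) :
    q' = baseChange A q := by
  apply baseChange_ext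
  intro v
  rw [h, baseChange_tmul, mul_one, Algebra.algebraMap_eq_smul_one]

end BaseChange

/-- The special orthogonal group of a quadratic form on a free module of finite rank over a
domain `A` with `2 ≠ 0`: the linear automorphisms preserving `q`, of determinant `1`. (Over such
a ring, and for regular `q`, this also is the kernel of the Dickson invariant in even rank.) -/
def SO {A M : Type*} [CommRing A] [AddCommGroup M] [Module A M]
    (q : QuadraticForm A M) : Subgroup (M ≃ₗ[A] M) where
  carrier := {g | (∀ x, q (g x) = q x) ∧ LinearEquiv.det g = 1}
  one_mem' := ⟨fun _ => rfl, map_one _⟩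
  mul_mem' := by
    rintro g h ⟨hg, hg'⟩ ⟨hh, hh'⟩
    exact ⟨fun x => by rw [LinearEquiv.mul_apply, hg, hh], by rw [map_mul, hg', hh', one_mul]⟩
  inv_mem' := by
    rintro g ⟨hg, hg'⟩
    refine ⟨fun x => ?_, by rw [map_inv, hg', inv_one]⟩
    rw [← hg (g⁻¹ x), ← LinearEquiv.mul_apply, mul_inv_cancel, LinearEquiv.coe_one, id]

end QuadZ

end

/-! Write `G = T + Tᵀ` for the Gram matrix of the polar form, where `T` is an integral, not
necessarily symmetric matrix with `q(x) = xᵀTx`. By regularity `|det G|` is 1 or 2, the latter only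
in odd rank. Let `ε = ±1`, let `g` be the matrix of `γ_p`, and put `h = εg`, again an isometry, so
that `P(ε) = ± det(1 - h)`.

The isometry `h` acts trivially on the discriminant group, whose order divides 2. Hence `1 - h = DG`
with `D` integral over `ℤ_p`, and the isometry relation becomes `DᵀGD = D + Dᵀ`, i.e. `D⁻¹ + D⁻ᵀ = T
+ Tᵀ`. So `xᵀD⁻¹x = xᵀTx` is integral, and `xᵀD⁻¹y` modulo `ℤ_p` is an alternating pairing with
kernel `Dᵀℤ_pⁿ`. A finite module with a nondegenerate alternating pairing has square order, so `det
D` has even valuation (`PadicInt.even_valuation_det`), and so has `P(ε) det G = ± det D (det G)²`.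
As `p` varies, `|P(ε) det G|` is a rational square.

It remains to remove the factors other than `Q(ε)`. Since `P` is self-reciprocal up to the sign
`(-1)ⁿ`, `a` and `n` have the same parity (`even_iff_of_reverse_eq`), and `n` is even when `|det G|
= 1`. So `2^a |det G|` is a square, which settles `ε = -1`; if `a = 0` then `|det G| = 1`, which
settles `ε = 1`. Finally `Q` has integer coefficients, so the squares are squares of integers. -/

section AlternatingPairing

/-! ### Alternating pairings on finite modules -/

variable {R M : Type*} [CommRing R] [AddCommGroup M] [Module R M]

theorem card_eq_card_ker_mul_card_range {N : Type*} [AddCommGroup N] [Module R N]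
    (f : M →ₗ[R] N) :
    Nat.card M = Nat.card (LinearMap.ker f) * Nat.card (LinearMap.range f) := by
  rw [Submodule.card_eq_card_quotient_mul_card (LinearMap.ker f),
    Nat.card_congr (LinearMap.quotKerEquivRange f).toEquiv, mul_comm]

variable [IsPrincipalIdealRing R]

theorem exists_range_generator {d : R} (ψ : M →ₗ[R] R ⧸ Ideal.span {d}) :
    ∃ g, LinearMap.range ψ = R ∙ ψ g := by
  have h : Function.Surjective (algebraMap R (R ⧸ Ideal.span {d})) := Ideal.Quotient.mk_surjective
  obtain ⟨e, he⟩ := IsPrincipalIdealRing.principal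
    ((LinearMap.range ψ).comap (Algebra.linearMap R (R ⧸ Ideal.span {d})))
  have he' : algebraMap R (R ⧸ Ideal.span {d}) e ∈ LinearMap.range ψ := by
    have : e ∈ (LinearMap.range ψ).comap (Algebra.linearMap R (R ⧸ Ideal.span {d})) :=
      he ▸ Submodule.mem_span_singleton_self e
    simpa using this
  obtain ⟨g, hg⟩ := he'
  refine ⟨g, le_antisymm ?_ ?_⟩
  · intro y hy
    obtain ⟨x, rfl⟩ := h y
    have : x ∈ (LinearMap.range ψ).comap (Algebra.linearMap R (R ⧸ Ideal.span {d})) := hy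
    rw [he] at this
    obtain ⟨c, rfl⟩ := Submodule.mem_span_singleton.1 this
    rw [smul_eq_mul, map_mul, ← hg, ← Algebra.smul_def]
    exact Submodule.smul_mem _ _ (Submodule.mem_span_singleton_self _)
  · rw [Submodule.span_singleton_le_iff_mem]
    exact ⟨g, rfl⟩

/-- Both modules are cyclic, and their generators `ψ g` and `ψ` have the same annihilator. -/
theorem card_range_eq_card_span {d : R} (ψ : M →ₗ[R] R ⧸ Ideal.span {d}) :
    Nat.card (LinearMap.range ψ) = Nat.card (R ∙ ψ) := by
  obtain ⟨g, hg⟩ := exists_range_generator ψ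
  have hker : LinearMap.ker (LinearMap.toSpanSingleton R _ (ψ g)) =
      LinearMap.ker (LinearMap.toSpanSingleton R _ ψ) := by
    ext c
    simp only [LinearMap.mem_ker, LinearMap.toSpanSingleton_apply]
    refine ⟨fun hc => LinearMap.ext fun x => ?_, fun hc => by
      rw [← LinearMap.smul_apply, hc, LinearMap.zero_apply]⟩
    obtain ⟨k, hk⟩ := Submodule.mem_span_singleton.1 (hg ▸ LinearMap.mem_range_self ψ x)
    rw [LinearMap.smul_apply, ← hk, smul_comm, hc, smul_zero, LinearMap.zero_apply]
  rw [hg, ← LinearMap.range_toSpanSingleton, ← LinearMap.range_toSpanSingleton,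
    ← Nat.card_congr (LinearMap.quotKerEquivRange _).toEquiv,
    ← Nat.card_congr (LinearMap.quotKerEquivRange _).toEquiv, hker]

variable [IsDomain R]

/-- With `e = gcd(a, d)`, the class of `a` is killed by `f = d / e`; that `f` also kills `b` forces
`e ∣ b`, and `e` is a multiple of `a` modulo `d`. -/
theorem exists_eq_smul_of_annihilator_le {d : R} (hd : d ≠ 0) (s t : R ⧸ Ideal.span {d})
    (h : ∀ f : R, f • s = 0 → f • t = 0) : ∃ m : R, t = m • s := by
  obtain ⟨a, rfl⟩ := Ideal.Quotient.mk_surjective s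
  obtain ⟨b, rfl⟩ := Ideal.Quotient.mk_surjective t
  obtain ⟨e, he⟩ := IsPrincipalIdealRing.principal (Ideal.span {a, d})
  rw [Ideal.submodule_span_eq] at he
  have hea : e ∣ a := Ideal.mem_span_singleton.1 (he ▸ Ideal.subset_span (by simp))
  have hed : e ∣ d := Ideal.mem_span_singleton.1 (he ▸ Ideal.subset_span (by simp))
  obtain ⟨f, hf⟩ := hed
  obtain ⟨a', ha'⟩ := hea
  have key : ∀ x c : R, c • Ideal.Quotient.mk (Ideal.span {d}) x = 0 ↔ d ∣ c * x := by
    intro x c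
    rw [Algebra.smul_def, Ideal.Quotient.algebraMap_eq, ← map_mul, Ideal.Quotient.eq_zero_iff_mem,
      Ideal.mem_span_singleton]
  have hfb := (key b f).1 (h f ((key a f).2 ⟨a', by rw [ha', hf]; ring⟩))
  obtain ⟨y, hy⟩ := hfb
  have hf0 : f ≠ 0 := by rintro rfl; simp at hf; exact hd hf
  have hb : b = e * y := mul_left_cancel₀ hf0 (by rw [hy, hf]; ring)
  have : e ∈ Ideal.span {a, d} := he ▸ Ideal.mem_span_singleton_self e
  obtain ⟨u, v, huv⟩ := Ideal.mem_span_pair.1 this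
  refine ⟨u * y, ?_⟩
  rw [Algebra.smul_def, Ideal.Quotient.algebraMap_eq, ← map_mul, Ideal.Quotient.eq,
    Ideal.mem_span_singleton]
  exact ⟨v * y, by rw [hb, ← huv]; ring⟩

theorem exists_eq_smul_of_ker_le {d : R} (hd : d ≠ 0) {φ ψ : M →ₗ[R] R ⧸ Ideal.span {d}}
    (h : LinearMap.ker ψ ≤ LinearMap.ker φ) : ∃ m : R, φ = m • ψ := by
  obtain ⟨g, hg⟩ := exists_range_generator ψ
  obtain ⟨m, hm⟩ := exists_eq_smul_of_annihilator_le hd (ψ g) (φ g) fun f hf => by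
    rw [← map_smul] at hf ⊢
    exact h hf
  refine ⟨m, LinearMap.ext fun x => ?_⟩
  obtain ⟨c, hc⟩ := Submodule.mem_span_singleton.1 (hg ▸ LinearMap.mem_range_self ψ x)
  have : φ (x - c • g) = 0 := h (by simp [hc])
  rw [map_sub, sub_eq_zero, map_smul, hm] at this
  rw [this, LinearMap.smul_apply, ← hc, smul_comm]

/-- The radical of an alternating pairing on a finite module, with values in a quotient of the
base ring, has square index. -/
theorem exists_card_eq_sq_mul_card_ker {d : R} (hd : d ≠ 0) :
    ∀ (N : ℕ) (M : Type _) [AddCommGroup M] [Module R M] [Finite M], Nat.card M = N →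
      ∀ B : M →ₗ[R] M →ₗ[R] R ⧸ Ideal.span {d}, (∀ x, B x x = 0) →
        ∃ k : ℕ, Nat.card M = k ^ 2 * Nat.card (LinearMap.ker B) := by
  intro N
  induction N using Nat.strong_induction_on with
  | _ N ih =>
    intro M _ _ _ hN B hB
    by_cases hB0 : B = 0
    · refine ⟨1, ?_⟩
      rw [hB0, LinearMap.ker_zero, one_pow, one_mul]
      exact (Nat.card_congr Submodule.topEquiv.toEquiv).symm
    obtain ⟨x, hx⟩ : ∃ x, B x ≠ 0 := by
      by_contra! h
      exact hB0 (LinearMap.ext h)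
    have hneg : ∀ y z, B y z = - B z y := fun y z =>
      (LinearMap.IsAlt.neg (B := B) hB z y).symm
    -- Induct on the orthogonal of `x`, which contains `x` itself. Passing to it divides the order
    -- by `|R ∙ B x|` and multiplies the order of the radical by the same number.
    let M₁ := LinearMap.ker (B x)
    let B₁ : M₁ →ₗ[R] M₁ →ₗ[R] R ⧸ Ideal.span {d} := B.domRestrict₁₂ M₁ M₁
    have hlt : Nat.card M₁ < N := by
      rw [← hN]
      have : (M₁ : Set M) ⊂ Set.univ := by
        rw [Set.ssubset_univ_iff]
        intro h
        exact hx (LinearMap.ext fun y => (h ▸ Set.mem_univ y : y ∈ (M₁ : Set M)))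
      have h2 := Set.ncard_lt_ncard this
      rwa [Set.ncard_univ, ← Nat.card_coe_set_eq] at h2
    obtain ⟨k, hk⟩ := ih _ hlt M₁ rfl B₁ fun y => hB y
    have h1 := card_eq_card_ker_mul_card_range (B x)
    let K₁ := LinearMap.ker B₁
    let f : K₁ →ₗ[R] M →ₗ[R] R ⧸ Ideal.span {d} := B ∘ₗ M₁.subtype ∘ₗ K₁.subtype
    have hK : Nat.card K₁ = Nat.card (LinearMap.ker B) * Nat.card (R ∙ B x) := by
      -- An element of the radical of `x^⊥` gives a form vanishing on `ker (B x)`, hence a multiple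
      -- of `B x`.
      have hr : LinearMap.range f = R ∙ B x := by
        apply le_antisymm
        · rintro _ ⟨y, rfl⟩
          have : LinearMap.ker (B x) ≤ LinearMap.ker (f y) := fun z hz => by
            have h3 : B₁ y = 0 := y.2
            exact LinearMap.congr_fun h3 ⟨z, hz⟩
          obtain ⟨m, hm⟩ := exists_eq_smul_of_ker_le hd this
          exact hm ▸ Submodule.smul_mem _ _ (Submodule.mem_span_singleton_self _)
        · rw [Submodule.span_singleton_le_iff_mem]
          exact ⟨⟨⟨x, hB x⟩, LinearMap.ext fun y => y.2⟩, rfl⟩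
      have hker : Nat.card (LinearMap.ker f) = Nat.card (LinearMap.ker B) := by
        refine Nat.card_congr ⟨fun y => ⟨y.1.1.1, y.2⟩, fun y => ⟨⟨⟨y.1, ?_⟩, ?_⟩, ?_⟩, ?_, ?_⟩
        · show B x y.1 = 0
          rw [hneg, show B y.1 = 0 from y.2]; simp
        · refine LinearMap.ext fun z => ?_
          show B y.1 z.1 = 0
          rw [show B y.1 = 0 from y.2]; rfl
        · exact y.2
        · intro y; rfl
        · intro y; rfl
      rw [card_eq_card_ker_mul_card_range f, hker, hr]
    refine ⟨k * Nat.card (R ∙ B x), ?_⟩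
    rw [h1, card_range_eq_card_span]
    change Nat.card M₁ * _ = _
    rw [hk]
    change k ^ 2 * Nat.card K₁ * _ = _
    rw [hK]
    ring

theorem exists_card_quotient_ker_eq_sq {d : R} (hd : d ≠ 0)
    (B : M →ₗ[R] M →ₗ[R] R ⧸ Ideal.span {d}) (hB : ∀ x, B x x = 0)
    [Finite (M ⧸ LinearMap.ker B)] :
    ∃ k : ℕ, Nat.card (M ⧸ LinearMap.ker B) = k ^ 2 := by
  have hneg : ∀ y z, B y z = - B z y := fun y z =>
    (LinearMap.IsAlt.neg (B := B) hB z y).symm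
  let N := LinearMap.ker B
  let B' : M ⧸ N →ₗ[R] M →ₗ[R] R ⧸ Ideal.span {d} := N.liftQ B le_rfl
  have hN : N ≤ LinearMap.ker B'.flip := by
    intro y hy
    refine LinearMap.ext fun z => ?_
    obtain ⟨z, rfl⟩ := N.mkQ_surjective z
    show B z y = 0
    rw [hneg, show B y = 0 from hy]; simp
  let B'' : M ⧸ N →ₗ[R] M ⧸ N →ₗ[R] R ⧸ Ideal.span {d} := (N.liftQ B'.flip hN).flip
  have hB'' : ∀ y z, B'' (N.mkQ y) (N.mkQ z) = B y z := fun y z => rfl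
  obtain ⟨k, hk⟩ := exists_card_eq_sq_mul_card_ker hd _ (M ⧸ N) rfl B'' (fun x => by
    obtain ⟨x, rfl⟩ := N.mkQ_surjective x
    rw [hB'', hB])
  have : LinearMap.ker B'' = ⊥ := by
    rw [LinearMap.ker_eq_bot']
    intro y hy
    obtain ⟨y, rfl⟩ := N.mkQ_surjective y
    rw [Submodule.mkQ_apply, Submodule.Quotient.mk_eq_zero]
    refine LinearMap.ext fun z => ?_
    rw [← hB'', hy]; rfl
  refine ⟨k, ?_⟩
  rw [this] at hk
  simpa using hk

end AlternatingPairing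

/-! ### Orders of cokernels over `ℤ_p` -/

section PadicCokernel

variable {p : ℕ} [Fact p.Prime]

theorem PadicInt.valuation_eq_of_associated {x y : ℤ_[p]} (h : Associated x y) :
    x.valuation = y.valuation := by
  obtain ⟨u, rfl⟩ := h
  by_cases hx : x = 0
  · simp [hx]
  have hu : (u : ℤ_[p]).valuation = 0 := by
    have h1 : ((u : ℤ_[p]) * (u⁻¹ : ℤ_[p]ˣ)).valuation = 0 := by simp
    rw [PadicInt.valuation_mul u.ne_zero (u⁻¹).ne_zero] at h1
    omega
  rw [PadicInt.valuation_mul hx u.ne_zero, hu, add_zero]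

theorem PadicInt.card_quotient_span_singleton {x : ℤ_[p]} (hx : x ≠ 0) :
    Nat.card (ℤ_[p] ⧸ Ideal.span {x}) = p ^ x.valuation := by
  have h1 : Ideal.span {x} = RingHom.ker (PadicInt.toZModPow (p := p) x.valuation) := by
    rw [PadicInt.ker_toZModPow, Ideal.span_singleton_eq_span_singleton]
    conv_lhs => rw [PadicInt.unitCoeff_spec hx]
    exact (associated_unit_mul_left _ _ (Units.isUnit _))
  have h2 : Function.Surjective (PadicInt.toZModPow (p := p) x.valuation) :=
    ZMod.ringHom_surjective _
  rw [h1, Nat.card_congr (RingHom.quotientKerEquivOfSurjective h2).toEquiv, Nat.card_zmod]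

theorem PadicInt.valuation_prod {ι : Type*} (s : Finset ι) (a : ι → ℤ_[p])
    (ha : ∀ i, a i ≠ 0) : (∏ i ∈ s, a i).valuation = ∑ i ∈ s, (a i).valuation := by
  classical
  induction s using Finset.induction_on with
  | empty => simp
  | insert i s hi ih =>
    rw [Finset.prod_insert hi, Finset.sum_insert hi,
      PadicInt.valuation_mul (ha i) (Finset.prod_ne_zero_iff.2 fun j _ => ha j), ih]

-- By Smith normal form the cokernel is a product of cyclic modules, and the product of the
-- invariant factors is the determinant up to a unit.
open Module Submodule in
theorem PadicInt.card_quotient_range_mulVecLin {n : Type*} [Fintype n] [DecidableEq n]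
    (A : Matrix n n ℤ_[p]) (hA : A.det ≠ 0) :
    Nat.card ((n → ℤ_[p]) ⧸ LinearMap.range A.mulVecLin) = p ^ A.det.valuation := by
  let N := LinearMap.range A.mulVecLin
  have hinj : Function.Injective A.mulVecLin := Matrix.mulVec_injective_of_det_ne_zero hA
  let e : (n → ℤ_[p]) ≃ₗ[ℤ_[p]] N := LinearEquiv.ofInjective A.mulVecLin hinj
  let b := Pi.basisFun ℤ_[p] n
  have h : Module.finrank ℤ_[p] N = Module.finrank ℤ_[p] (n → ℤ_[p]) := e.symm.finrank_eq
  let a := smithNormalFormCoeffs b h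
  let b' := smithNormalFormTopBasis b h
  let ab := smithNormalFormBotBasis b h
  have ab_eq := smithNormalFormBotBasis_def b h
  have ha0 : ∀ i, a i ≠ 0 := smithNormalFormCoeffs_ne_zero b h
  let e' : (n → ℤ_[p]) ≃ₗ[ℤ_[p]] N := b'.equiv ab (Equiv.refl _)
  let f : (n → ℤ_[p]) →ₗ[ℤ_[p]] (n → ℤ_[p]) := N.subtype.comp (e' : (n → ℤ_[p]) →ₗ[ℤ_[p]] N)
  have hf : ∀ i, f (b' i) = a i • b' i := by
    intro i
    change ((b'.equiv ab (Equiv.refl _) (b' i) : N) : n → ℤ_[p]) = _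
    rw [b'.equiv_apply, Equiv.refl_apply]
    exact ab_eq i
  have hdet : LinearMap.det f = ∏ i, a i := by
    rw [← LinearMap.det_toMatrix b', ← Matrix.det_diagonal]
    congr 1
    ext i j
    rw [LinearMap.toMatrix_apply, hf, map_smul, Basis.repr_self, Finsupp.smul_single,
      smul_eq_mul, mul_one]
    by_cases h : i = j
    · rw [h, Matrix.diagonal_apply_eq, Finsupp.single_eq_same]
    · rw [Matrix.diagonal_apply_ne _ h, Finsupp.single_eq_of_ne h]
  have hassoc : Associated A.det (LinearMap.det f) := by
    have h1 : LinearMap.det (N.subtype ∘ₗ (e : (n → ℤ_[p]) →ₗ[ℤ_[p]] N)) = A.det := by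
      rw [← LinearMap.det_toLin' A]
      congr 1
    rw [← h1]
    exact LinearMap.associated_det_comp_equiv _ _ _
  rw [PadicInt.valuation_eq_of_associated hassoc, hdet, PadicInt.valuation_prod _ _ ha0,
    Nat.card_congr (quotientEquivPiSpan N b h).toEquiv, Nat.card_pi, ← Finset.prod_pow_eq_pow_sum]
  exact Finset.prod_congr rfl fun i _ => PadicInt.card_quotient_span_singleton (ha0 i)

open Matrix in
theorem PadicInt.even_valuation_det {n : Type*} [Fintype n] [DecidableEq n]
    {D T : Matrix n n ℤ_[p]} (hD : D.det ≠ 0) (h : Dᵀ * (T + Tᵀ) * D = D + Dᵀ) :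
    Even D.det.valuation := by
  have hE : D.det • (T + Tᵀ) = D.adjugate + D.adjugateᵀ := by
    have h1 : D.adjugateᵀ * (Dᵀ * (T + Tᵀ) * D) * D.adjugate
        = D.adjugateᵀ * (D + Dᵀ) * D.adjugate := by rw [h]
    have h2 : D.adjugateᵀ * Dᵀ = D.det • (1 : Matrix n n ℤ_[p]) := by
      rw [← transpose_mul, mul_adjugate, transpose_smul, transpose_one]
    have h3 : D.adjugateᵀ * (Dᵀ * (T + Tᵀ) * D) * D.adjugate
        = D.det • (D.det • (T + Tᵀ)) := by
      calc _ = (D.adjugateᵀ * Dᵀ) * (T + Tᵀ) * (D * D.adjugate) := by simp only [Matrix.mul_assoc]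
        _ = _ := by rw [h2, mul_adjugate]; simp
    have h4 : D.adjugateᵀ * (D + Dᵀ) * D.adjugate
        = D.det • (D.adjugate + D.adjugateᵀ) := by
      rw [Matrix.mul_add, h2, Matrix.add_mul, Matrix.mul_assoc, mul_adjugate]
      simp [add_comm]
    rw [h3, h4] at h1
    exact smul_right_injective _ hD h1
  let B : (n → ℤ_[p]) →ₗ[ℤ_[p]] (n → ℤ_[p]) →ₗ[ℤ_[p]] ℤ_[p] ⧸ Ideal.span {D.det} :=
    (Matrix.toLinearMap₂' ℤ_[p] D.adjugate).compr₂ (Ideal.span {D.det}).mkQ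
  have hBapply : ∀ x y, B x y = 0 ↔ D.det ∣ x ⬝ᵥ D.adjugate *ᵥ y := by
    intro x y
    rw [← Ideal.mem_span_singleton, ← Submodule.Quotient.mk_eq_zero,
      ← Matrix.toLinearMap₂'_apply']
    rfl
  have hB : ∀ x, B x x = 0 := by
    intro x
    rw [hBapply]
    -- The diagonal of `hE` is twice the desired identity; cancelling 2 makes the pairing
    -- alternating, not merely antisymmetric, even for `p = 2`.
    refine ⟨x ⬝ᵥ T *ᵥ x, mul_left_cancel₀ (two_ne_zero : (2 : ℤ_[p]) ≠ 0) ?_⟩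
    have ht : ∀ S : Matrix n n ℤ_[p], x ⬝ᵥ Sᵀ *ᵥ x = x ⬝ᵥ S *ᵥ x := by
      intro S
      rw [mulVec_transpose, dotProduct_comm, ← dotProduct_mulVec]
    have h5 := congrArg (fun S => x ⬝ᵥ S *ᵥ x) hE
    simp only [smul_mulVec, add_mulVec, dotProduct_add, dotProduct_smul, ht, smul_eq_mul] at h5
    linear_combination -h5
  have hker : LinearMap.ker B = LinearMap.range Dᵀ.mulVecLin := by
    ext x
    constructor
    · intro hx
      have hdvd : ∀ i, D.det ∣ (D.adjugateᵀ *ᵥ x) i := by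
        intro i
        have h6 := (hBapply x (Pi.single i 1)).1 (by rw [show B x = 0 from hx]; rfl)
        rwa [dotProduct_mulVec, dotProduct_single, mul_one, ← mulVec_transpose] at h6
      choose z hz using hdvd
      refine ⟨z, ?_⟩
      have h7 : D.adjugateᵀ *ᵥ x = D.det • z := funext hz
      have h8 : Dᵀ *ᵥ (D.adjugateᵀ *ᵥ x) = D.det • x := by
        rw [mulVec_mulVec, ← transpose_mul, adjugate_mul, transpose_smul, transpose_one,
          smul_mulVec, one_mulVec]
      rw [h7, mulVec_smul] at h8
      exact smul_right_injective _ hD h8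
    · rintro ⟨z, rfl⟩
      refine LinearMap.ext fun y => ?_
      rw [LinearMap.zero_apply, hBapply, mulVecLin_apply, mulVec_transpose, ← dotProduct_mulVec,
        mulVec_mulVec, mul_adjugate, smul_mulVec, one_mulVec, dotProduct_smul]
      exact Dvd.intro _ rfl
  have hcard := PadicInt.card_quotient_range_mulVecLin Dᵀ (by rwa [det_transpose])
  rw [det_transpose, ← hker] at hcard
  have hp := (Fact.out : p.Prime)
  have : Finite ((n → ℤ_[p]) ⧸ LinearMap.ker B) :=
    Nat.finite_of_card_ne_zero (by rw [hcard]; exact pow_ne_zero _ hp.ne_zero)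
  obtain ⟨k, hk⟩ := exists_card_quotient_ker_eq_sq hD B hB
  rw [hcard] at hk
  have h9 := congrArg (padicValNat p) hk
  rw [padicValNat.prime_pow, padicValNat.pow] at h9
  exact ⟨padicValNat p k, by omega⟩

end PadicCokernel

/-! ### Isometries over `ℤ_p` -/

section PadicIsometry

variable {p : ℕ} [Fact p.Prime] {ι : Type*} [Fintype ι] [DecidableEq ι]

-- `hᵀ` induces an automorphism of the cokernel of `G`, and a group of order at most 2 has only the
-- trivial one.
open Matrix in
theorem sub_transpose_mulVec_mem_range {G h : Matrix ι ι ℤ_[p]} (hG : G.det ≠ 0)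
    (hiso : hᵀ * G * h = G)
    (hcard : Nat.card ((ι → ℤ_[p]) ⧸ LinearMap.range G.mulVecLin) ∣ 2) (x : ι → ℤ_[p]) :
    x - hᵀ *ᵥ x ∈ LinearMap.range G.mulVecLin := by
  have hdet : h.det ≠ 0 := by
    intro h0
    apply hG
    rw [← hiso, det_mul, h0, mul_zero]
  have hsymm : ∀ x, hᵀ *ᵥ x ∈ LinearMap.range G.mulVecLin ↔ x ∈ LinearMap.range G.mulVecLin := by
    intro x
    constructor
    · rintro ⟨z, hz⟩
      refine ⟨h *ᵥ z, ?_⟩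
      apply mulVec_injective_of_det_ne_zero (M := hᵀ) (by rwa [det_transpose])
      rw [← hz, mulVecLin_apply, mulVecLin_apply, mulVec_mulVec, mulVec_mulVec, hiso]
    · rintro ⟨z, rfl⟩
      have hdet1 : IsUnit h.det := by
        have h1 := congrArg det hiso
        rw [det_mul, det_mul, det_transpose] at h1
        have h2 : h.det * h.det = 1 := mul_right_cancel₀ hG (by linear_combination h1)
        exact IsUnit.of_mul_eq_one _ h2
      refine ⟨h⁻¹ *ᵥ z, ?_⟩
      rw [mulVecLin_apply, mulVecLin_apply, mulVec_mulVec, mulVec_mulVec]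
      congr 1
      conv_lhs => rw [← hiso]
      rw [Matrix.mul_assoc, mul_nonsing_inv _ hdet1, Matrix.mul_one]
  by_cases hx : x ∈ LinearMap.range G.mulVecLin
  · exact Submodule.sub_mem _ hx ((hsymm x).2 hx)
  rcases (Nat.dvd_prime Nat.prime_two).1 hcard with h1 | h2
  · have h3 : (LinearMap.range G.mulVecLin).toAddSubgroup.index = 1 := h1
    rw [AddSubgroup.index_eq_one] at h3
    have : x ∈ (LinearMap.range G.mulVecLin).toAddSubgroup := h3 ▸ AddSubgroup.mem_top x
    exact absurd this hx
  · have h3 : (LinearMap.range G.mulVecLin).toAddSubgroup.index = 2 := h2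
    have := (AddSubgroup.add_mem_iff_of_index_two h3 (a := x) (b := - (hᵀ *ᵥ x))).2
      ⟨fun h => absurd h hx, fun h => absurd ((hsymm x).1 (neg_mem_iff.1 h)) hx⟩
    rwa [← sub_eq_add_neg] at this

open Matrix in
theorem even_valuation_det_one_sub_add {T : Matrix ι ι ℤ_[p]} {h : Matrix ι ι ℤ_[p]}
    (hG : (T + Tᵀ).det ≠ 0) (hdvd : p ^ (T + Tᵀ).det.valuation ∣ 2)
    (hiso : hᵀ * (T + Tᵀ) * h = T + Tᵀ) (hdet : (1 - h).det ≠ 0) :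
    Even ((1 - h).det.valuation + (T + Tᵀ).det.valuation) := by
  set G := T + Tᵀ with hGdef
  have hGt : Gᵀ = G := by rw [hGdef, transpose_add, transpose_transpose, add_comm]
  rw [← PadicInt.card_quotient_range_mulVecLin G hG] at hdvd
  choose z hz using fun j => sub_transpose_mulVec_mem_range hG hiso hdvd (Pi.single j 1)
  let D : Matrix ι ι ℤ_[p] := Matrix.of z
  have hDG : D * G = 1 - h := by
    rw [← transpose_inj, transpose_mul, hGt, transpose_sub, transpose_one]
    refine Matrix.ext fun i j => ?_
    have h1 := congrFun (hz j) i
    rw [mulVecLin_apply] at h1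
    rw [Matrix.sub_apply, one_apply]
    rw [Pi.sub_apply, mulVec_single_one, col_apply, Pi.single_apply] at h1
    rw [← h1]
    rfl
  have hdetDG : D.det * G.det = (1 - h).det := by rw [← det_mul, hDG]
  have hD : D.det ≠ 0 := by
    intro h0
    rw [h0, zero_mul] at hdetDG
    exact hdet hdetDG.symm
  -- Expand `(1 - h)ᵀ G (1 - h)` using `hᵀGh = G`, substitute `1 - h = DG`, and cancel `G` on both
  -- sides.
  have hrel : Dᵀ * G * D = D + Dᵀ := by
    have h1 : (1 - h)ᵀ * G * (1 - h) = G * (1 - h) + (1 - h)ᵀ * G := by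
      have h2 : (1 - h)ᵀ * G * (1 - h) = G - G * h - hᵀ * G + hᵀ * G * h := by
        rw [transpose_sub, transpose_one]
        noncomm_ring
      rw [h2, hiso, transpose_sub, transpose_one]
      noncomm_ring
    rw [← hDG, transpose_mul, hGt] at h1
    have h3 : G * (Dᵀ * G * D) * G = G * (D + Dᵀ) * G := by
      simp only [Matrix.mul_add, Matrix.add_mul, Matrix.mul_assoc] at h1 ⊢
      exact h1
    have hGreg : ∀ A B : Matrix ι ι ℤ_[p], G * A * G = G * B * G → A = B := by
      intro A B hAB
      have h4 := congrArg (fun S => G.adjugate * S * G.adjugate) hAB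
      have h5 : ∀ A, G.adjugate * (G * A * G) * G.adjugate = G.det • (G.det • A) := by
        intro A
        calc _ = (G.adjugate * G) * A * (G * G.adjugate) := by simp only [Matrix.mul_assoc]
          _ = _ := by rw [adjugate_mul, mul_adjugate]; simp
      simp only [h5] at h4
      exact smul_right_injective _ hG (smul_right_injective _ hG h4)
    exact hGreg _ _ h3
  obtain ⟨k, hk⟩ := PadicInt.even_valuation_det hD hrel
  rw [← hdetDG, PadicInt.valuation_mul hD hG]
  exact ⟨k + G.det.valuation, by omega⟩

end PadicIsometry

/-! ### Self-reciprocal polynomials and parity of the rank -/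

section SelfReciprocal

-- `gᵀ = G g⁻¹ G⁻¹`, so `g` and `g⁻¹` have the same characteristic polynomial.
open Matrix in
theorem Matrix.reverse_charpoly_of_isometry {K ι : Type*} [Field K] [Fintype ι] [DecidableEq ι]
    {G g : Matrix ι ι K} (hG : G.det ≠ 0) (hiso : gᵀ * G * g = G) (hdet : g.det = 1) :
    g.charpoly.reverse = (-1) ^ Fintype.card ι * g.charpoly := by
  have hg : IsUnit g := (isUnit_iff_isUnit_det g).2 (by rw [hdet]; exact isUnit_one)
  have hGu : IsUnit G.det := isUnit_iff_ne_zero.2 hG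
  have h1 := charpoly_inv g hg
  have h2 : gᵀ = G * g⁻¹ * G⁻¹ := by
    have h3 : gᵀ * G = G * g⁻¹ := by
      conv_rhs => rw [← hiso]
      rw [Matrix.mul_assoc, mul_nonsing_inv _ (by rw [hdet]; exact isUnit_one), Matrix.mul_one]
    rw [← h3, Matrix.mul_assoc, mul_nonsing_inv _ hGu, Matrix.mul_one]
  have h4 : g⁻¹.charpoly = g.charpoly := by
    rw [← charpoly_transpose g, h2, charpoly_mul_comm, ← Matrix.mul_assoc,
      nonsing_inv_mul _ hGu, Matrix.one_mul]
  rw [h4, hdet] at h1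
  rw [reverse_charpoly]
  conv_rhs => rw [h1]
  simp [← mul_assoc, ← pow_add, ← two_mul]

theorem Polynomial.reverse_pow_of_domain {R : Type*} [Semiring R] [NoZeroDivisors R] [Nontrivial R]
    (f : R[X]) (n : ℕ) : (f ^ n).reverse = f.reverse ^ n := by
  induction n with
  | zero => rw [pow_zero, pow_zero, ← C_1, reverse_C]
  | succ n ih => rw [pow_succ, pow_succ, reverse_mul_of_domain, ih]

theorem Polynomial.reverse_map_of_injective {R S : Type*} [Semiring R] [Semiring S] (f : R →+* S)
    (hf : Function.Injective f) (P : R[X]) : (P.map f).reverse = P.reverse.map f := by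
  rw [reverse, reverse, natDegree_map_eq_of_injective hf, reflect_map]

/-- Reversal negates `X - 1`, fixes `X + 1` and preserves the value at 1; compare signs at 1 after
cancelling the linear factors. -/
theorem even_iff_of_reverse_eq {a b n : ℕ} {P Q : ℚ[X]}
    (hP : P = (X - 1) ^ a * (X + 1) ^ (2 * b) * Q) (hQ : Q.eval 1 ≠ 0)
    (hrev : P.reverse = (-1) ^ n * P) : Even a ↔ Even n := by
  have hX : (X : ℚ[X]).reverse = 1 := by
    rw [← one_mul X, reverse_mul_X, ← C_1, reverse_C]
  have h1 : (X - 1 : ℚ[X]).reverse = -(X - 1) := by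
    have h := reverse_add_C (X : ℚ[X]) (-1)
    rw [hX, C_neg, C_1, natDegree_X, ← sub_eq_add_neg] at h
    rw [h]
    ring
  have h2 : (X + 1 : ℚ[X]).reverse = X + 1 := by
    have h := reverse_add_C (X : ℚ[X]) 1
    rw [hX, C_1, natDegree_X] at h
    rw [h]
    ring
  have hX1 : (X - 1 : ℚ[X]) ≠ 0 := X_sub_C_ne_zero 1
  have hX2 : (X + 1 : ℚ[X]) ≠ 0 := X_add_C_ne_zero 1
  rw [hP, reverse_mul_of_domain, reverse_mul_of_domain, reverse_pow_of_domain,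
    reverse_pow_of_domain, h1, h2] at hrev
  have h3 : (-1) ^ a * Q.reverse = (-1) ^ n * Q := by
    apply mul_left_cancel₀ (mul_ne_zero (pow_ne_zero a hX1) (pow_ne_zero (2 * b) hX2))
    rw [neg_pow] at hrev
    linear_combination hrev
  have h4 : Q.reverse.eval 1 = Q.eval 1 := by
    let : Invertible (1 : ℚ) := invertibleOne
    have := eval₂_reverse_mul_pow (RingHom.id ℚ) (1 : ℚ) Q
    simpa [eval₂_id] using this
  have h5 := congrArg (eval 1) h3
  simp only [eval_mul, eval_pow, eval_neg, eval_one, h4] at h5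
  have h6 := mul_right_cancel₀ hQ h5
  have hne : (-1 : ℚ) ≠ 1 := by norm_num
  rw [← neg_one_pow_eq_one_iff_even hne, h6, neg_one_pow_eq_one_iff_even hne]

-- Modulo 2, `T + Tᵀ` agrees with the antisymmetric `T - Tᵀ`, whose determinant vanishes in odd
-- size.
open Matrix in
theorem even_card_of_odd_det_add_transpose {ι : Type*} [Fintype ι] [DecidableEq ι]
    (T : Matrix ι ι ℤ) (h : Odd (T + Tᵀ).det) : Even (Fintype.card ι) := by
  by_contra hn
  rw [Nat.not_even_iff_odd] at hn
  have h1 : (T - Tᵀ).det = 0 := by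
    have h2 : (T - Tᵀ).det = -(T - Tᵀ).det := by
      conv_lhs => rw [← det_transpose, transpose_sub, transpose_transpose, ← neg_sub, det_neg,
        hn.neg_one_pow]
      ring
    omega
  have h3 : (Int.castRingHom (ZMod 2)) (T + Tᵀ).det = (Int.castRingHom (ZMod 2)) (T - Tᵀ).det := by
    rw [RingHom.map_det, RingHom.map_det]
    congr 1
    ext i j
    simp [CharTwo.sub_eq_add]
  rw [h1, map_zero, eq_intCast, ZMod.intCast_zmod_eq_zero_iff_dvd] at h3
  rw [← Int.not_even_iff_odd] at h
  exact h (even_iff_two_dvd.2 (by exact_mod_cast h3))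

end SelfReciprocal

/-! ### Squares detected by valuations -/

section Squares

theorem Nat.isSquare_of_forall_even_padicValNat {m : ℕ} (hm : m ≠ 0)
    (h : ∀ p : ℕ, p.Prime → Even (padicValNat p m)) : IsSquare m := by
  rw [← Nat.prod_factorization_pow_eq_self hm]
  refine Finset.isSquare_prod _ fun p hp => ?_
  have hp' := Nat.prime_of_mem_primeFactors (Nat.support_factorization m ▸ hp)
  rw [Nat.factorization_def _ hp']
  exact (h p hp').isSquare_pow _

theorem Rat.isSquare_abs_of_forall_even_padicValRat {r : ℚ} (hr : r ≠ 0)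
    (h : ∀ p : ℕ, p.Prime → Even (padicValRat p r)) : IsSquare |r| := by
  have hn : r.num.natAbs ≠ 0 := Int.natAbs_ne_zero.2 (Rat.num_ne_zero.2 hr)
  obtain ⟨k, hk⟩ : IsSquare (r.num.natAbs * r.den) := by
    -- Numerator times denominator has the same valuation parities as their quotient.
    refine Nat.isSquare_of_forall_even_padicValNat (mul_ne_zero hn r.den_nz) fun p hp => ?_
    have := Fact.mk hp
    rw [padicValNat.mul hn r.den_nz]
    have h1 := h p hp
    unfold padicValRat padicValInt at h1
    rw [← Int.even_coe_nat, Nat.cast_add]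
    exact Int.even_add.2 (Int.even_sub.1 h1)
  refine ⟨k / r.den, ?_⟩
  have hd : (r.den : ℚ) ≠ 0 := Nat.cast_ne_zero.2 r.den_nz
  have h2 : |r| = r.num.natAbs / r.den := by
    conv_lhs => rw [← Rat.num_div_den r]
    rw [abs_div, Nat.abs_cast, Nat.cast_natAbs, Int.cast_abs]
  have h3 : (r.num.natAbs : ℚ) * r.den = k * k := by exact_mod_cast hk
  rw [h2, div_mul_div_comm, ← h3]
  field_simp

end Squares

/-! ### Gram matrices and base change -/

section GramMatrix

theorem LinearMap.IsPerfPair.isUnit_det_toMatrix {R V ι : Type*} [CommRing R] [AddCommGroup V]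
    [Module R V] [Fintype ι] [DecidableEq ι] (b : Module.Basis ι R V) (B : LinearMap.BilinForm R V)
    (hB : B.IsPerfPair) : IsUnit (LinearMap.BilinForm.toMatrix b B).det := by
  have h : LinearMap.BilinForm.toMatrix b B = (LinearMap.toMatrix b b.dualBasis B.toPerfPair).transpose := by
    ext i j
    rw [Matrix.transpose_apply, LinearMap.toMatrix_apply, LinearMap.BilinForm.toMatrix_apply,
      Module.Basis.dualBasis_repr]
    rfl
  rw [h, Matrix.det_transpose]
  exact LinearEquiv.isUnit_det B.toPerfPair b b.dualBasis

theorem QuadZ.IsRegular.exists_basis {V : Type*} [AddCommGroup V] [Module.Free ℤ V]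
    [Module.Finite ℤ V] {q : QuadraticForm ℤ V} (hq : QuadZ.IsRegular q) :
    ∃ (n : ℕ) (b : Module.Basis (Fin n) ℤ V),
      (LinearMap.BilinForm.toMatrix b q.polarBilin).det.natAbs = 1 ∨
        (Odd n ∧ (LinearMap.BilinForm.toMatrix b q.polarBilin).det.natAbs = 2) := by
  rcases hq with h | ⟨n, b, d, hn, hd, hu⟩
  · exact ⟨_, Module.finBasis ℤ V, Or.inl (Int.isUnit_iff_natAbs_eq.1
      (LinearMap.IsPerfPair.isUnit_det_toMatrix _ _ h))⟩
  · refine ⟨n, b, Or.inr ⟨hn, ?_⟩⟩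
    rw [hd, Int.natAbs_mul, Int.isUnit_iff_natAbs_eq.1 hu]
    rfl

theorem LinearMap.BilinForm.toMatrix_polarBilin_toQuadraticMap {R V ι : Type*} [CommRing R]
    [AddCommGroup V] [Module R V] [Fintype ι] [DecidableEq ι] (b : Module.Basis ι R V)
    (B : LinearMap.BilinForm R V) :
    LinearMap.BilinForm.toMatrix b (LinearMap.BilinMap.toQuadraticMap B).polarBilin =
      LinearMap.BilinForm.toMatrix b B + (LinearMap.BilinForm.toMatrix b B).transpose := by
  ext i j
  rw [Matrix.add_apply, Matrix.transpose_apply, LinearMap.BilinForm.toMatrix_apply, LinearMap.BilinForm.toMatrix_apply,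
    LinearMap.BilinForm.toMatrix_apply, QuadraticMap.polarBilin_apply_apply,
    LinearMap.BilinMap.polar_toQuadraticMap]

/-- `T` is the matrix of the very bilinear form chosen in `baseChange`, so one integral `T` serves
all rings `A`. -/
theorem QuadZ.exists_matrix_of_mem_SO {V ι : Type*} [AddCommGroup V] [Module.Free ℤ V]
    [Module.Finite ℤ V] [Fintype ι] [DecidableEq ι] (q : QuadraticForm ℤ V)
    (b : Module.Basis ι ℤ V) :
    ∃ T : Matrix ι ι ℤ, LinearMap.BilinForm.toMatrix b q.polarBilin = T + T.transpose ∧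
      ∀ (A : Type) [CommRing A],
        ∀ γ ∈ QuadZ.SO (QuadZ.baseChange A q), ∃ g : Matrix ι ι A,
          g.transpose * (T.map (Int.cast : ℤ → A) + (T.map (Int.cast : ℤ → A)).transpose) * g =
            T.map (Int.cast : ℤ → A) + (T.map (Int.cast : ℤ → A)).transpose ∧
          g.det = 1 ∧ g.charpoly = LinearMap.charpoly (γ : A ⊗[ℤ] V →ₗ[A] A ⊗[ℤ] V) := by
  have hB := Classical.choose_spec (LinearMap.BilinMap.toQuadraticMap_surjective q)
  refine ⟨LinearMap.BilinForm.toMatrix b (Classical.choose (LinearMap.BilinMap.toQuadraticMap_surjective q)), ?_, ?_⟩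
  · rw [← LinearMap.BilinForm.toMatrix_polarBilin_toQuadraticMap, hB]
  intro A _ γ hγ
  let bA := b.baseChange A
  have hT : LinearMap.BilinForm.toMatrix bA (LinearMap.BilinForm.baseChange A
      (Classical.choose (LinearMap.BilinMap.toQuadraticMap_surjective q))) =
      (LinearMap.BilinForm.toMatrix b (Classical.choose (LinearMap.BilinMap.toQuadraticMap_surjective q))).map
        (Int.cast : ℤ → A) := by
    ext i j
    rw [LinearMap.BilinForm.toMatrix_apply, Matrix.map_apply, LinearMap.BilinForm.toMatrix_apply,
      Module.Basis.baseChange_apply, Module.Basis.baseChange_apply, LinearMap.BilinForm.baseChange_tmul,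
      mul_one, zsmul_one]
  rw [← hT, ← LinearMap.BilinForm.toMatrix_polarBilin_toQuadraticMap]
  change ∃ g : Matrix ι ι A, g.transpose * LinearMap.BilinForm.toMatrix bA
    (QuadZ.baseChange A q).polarBilin * g = LinearMap.BilinForm.toMatrix bA
    (QuadZ.baseChange A q).polarBilin ∧ _
  refine ⟨LinearMap.toMatrix bA bA (γ : A ⊗[ℤ] V →ₗ[A] A ⊗[ℤ] V), ?_, ?_, ?_⟩
  · rw [← LinearMap.BilinForm.toMatrix_comp]
    congr 1
    ext x y
    simp [QuadraticMap.polar, ← map_add, hγ.1]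
  · rw [LinearMap.det_toMatrix, ← LinearEquiv.coe_det, hγ.2, Units.val_one]
  · exact LinearMap.charpoly_toMatrix _ _

end GramMatrix

/-! ### Integrality of `P` and `Q` -/

section Integrality

theorem Rat.den_eq_one_of_forall_norm_le_one {r : ℚ}
    (h : ∀ (p : ℕ) [Fact p.Prime], ‖(r : ℚ_[p])‖ ≤ 1) : r.den = 1 := by
  by_contra hd
  obtain ⟨p, hp, hpd⟩ := Nat.exists_prime_and_dvd hd
  have := Fact.mk hp
  have h1 := PadicInt.isUnit_iff.1 (PadicInt.isUnit_den r (h p))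
  rw [PadicInt.norm_natCast_eq_one_iff] at h1
  exact hp.one_lt.ne' (Nat.Coprime.eq_one_of_dvd h1 hpd)

theorem Polynomial.mem_lifts_int_of_forall_padic {P : ℚ[X]}
    (h : ∀ (p : ℕ) [Fact p.Prime], ∃ F : ℤ_[p][X],
      F.map (algebraMap ℤ_[p] ℚ_[p]) = P.map (algebraMap ℚ ℚ_[p])) :
    ∃ P₀ : ℤ[X], P₀.map (Int.castRingHom ℚ) = P := by
  have : P ∈ lifts (Int.castRingHom ℚ) := by
    rw [lifts_iff_coeff_lifts]
    intro n
    have hd : (P.coeff n).den = 1 := Rat.den_eq_one_of_forall_norm_le_one fun p _ => by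
      obtain ⟨F, hF⟩ := h p
      have h1 := congrArg (fun S => S.coeff n) hF
      simp only [coeff_map, eq_ratCast] at h1
      rw [← h1]
      exact PadicInt.norm_le_one (F.coeff n)
    exact ⟨(P.coeff n).num, (Rat.den_eq_one_iff _).1 hd⟩
  exact this

theorem Polynomial.exists_int_factor {P₀ F : ℤ[X]} {Q : ℚ[X]} (hF : F.Monic)
    (h : P₀.map (Int.castRingHom ℚ) = F.map (Int.castRingHom ℚ) * Q) :
    ∃ Q₀ : ℤ[X], Q₀.map (Int.castRingHom ℚ) = Q := by
  obtain ⟨Q₀, rfl⟩ := (map_dvd_map (Int.castRingHom ℚ) Int.cast_injective hF).1 ⟨Q, h⟩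
  refine ⟨Q₀, ?_⟩
  rw [Polynomial.map_mul] at h
  exact mul_left_cancel₀ (hF.map _).ne_zero h

end Integrality

/-! ### Parity of the valuation of `P(ε) det G` -/

section Parity

open Matrix in
theorem even_padicValRat_eval_mul_det {p n : ℕ} [Fact p.Prime] {T : Matrix (Fin n) (Fin n) ℤ}
    (hT : (T + Tᵀ).det.natAbs ∣ 2) {g : Matrix (Fin n) (Fin n) ℤ_[p]}
    (hg : gᵀ * (T.map (Int.cast : ℤ → ℤ_[p]) + (T.map (Int.cast : ℤ → ℤ_[p]))ᵀ) * g =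
      T.map (Int.cast : ℤ → ℤ_[p]) + (T.map (Int.cast : ℤ → ℤ_[p]))ᵀ) {P : ℚ[X]}
    (hP : g.charpoly.map (algebraMap ℤ_[p] ℚ_[p]) = P.map (algebraMap ℚ ℚ_[p]))
    {ε : ℤ} (hε : ε * ε = 1) (hne : P.eval (ε : ℚ) ≠ 0) :
    Even (padicValRat p (P.eval (ε : ℚ) * (T + Tᵀ).det)) := by
  set Tp := T.map (Int.cast : ℤ → ℤ_[p]) with hTp
  have hdetG : (Tp + Tpᵀ).det = ((T + Tᵀ).det : ℤ_[p]) := by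
    rw [← eq_intCast (Int.castRingHom ℤ_[p]), RingHom.map_det]
    congr 1
    ext i j
    simp [hTp]
  have hG0 : (T + Tᵀ).det ≠ 0 := by
    intro h0
    rw [h0] at hT
    simp at hT
  have hG0p : (Tp + Tpᵀ).det ≠ 0 := by
    rw [hdetG]
    exact Int.cast_ne_zero.2 hG0
  have hval : ((Tp + Tpᵀ).det.valuation : ℤ) = padicValRat p ((T + Tᵀ).det : ℚ) := by
    rw [hdetG, ← PadicInt.valuation_coe, PadicInt.coe_intCast, ← Padic.valuation_ratCast,
      Rat.cast_intCast]
  have hdvd : p ^ (Tp + Tpᵀ).det.valuation ∣ 2 := by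
    have h1 : (Tp + Tpᵀ).det.valuation = padicValNat p (T + Tᵀ).det.natAbs := by
      rw [padicValRat.of_int] at hval
      exact_mod_cast hval
    rw [h1]
    exact pow_padicValNat_dvd.trans hT
  have hεp : (ε : ℤ_[p]) * ε = 1 := by exact_mod_cast congrArg (Int.cast : ℤ → ℤ_[p]) hε
  have hiso : ((ε : ℤ_[p]) • g)ᵀ * (Tp + Tpᵀ) * ((ε : ℤ_[p]) • g) = Tp + Tpᵀ := by
    rw [transpose_smul, Matrix.smul_mul, Matrix.smul_mul, Matrix.mul_smul, smul_smul, hεp, one_smul,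
      hg]
  have heval : ((P.eval (ε : ℚ) : ℚ) : ℚ_[p]) =
      (((ε : ℤ_[p]) ^ n * (1 - (ε : ℤ_[p]) • g).det : ℤ_[p]) : ℚ_[p]) := by
    have h1 : ((P.eval (ε : ℚ) : ℚ) : ℚ_[p]) = (P.map (algebraMap ℚ ℚ_[p])).eval (ε : ℚ_[p]) := by
      have := eval_map_apply (f := algebraMap ℚ ℚ_[p]) (p := P) (ε : ℚ)
      simpa using this.symm
    have h2 : g.charpoly.eval (ε : ℤ_[p]) = (ε : ℤ_[p]) ^ n * (1 - (ε : ℤ_[p]) • g).det := by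
      rw [eval_charpoly]
      have h3 : scalar (Fin n) (ε : ℤ_[p]) - g = (ε : ℤ_[p]) • (1 - (ε : ℤ_[p]) • g) := by
        rw [smul_sub, smul_smul, hεp, one_smul, smul_one_eq_diagonal]
        rfl
      rw [h3, det_smul, Fintype.card_fin]
    rw [h1, ← hP, ← h2]
    have := eval_map_apply (f := algebraMap ℤ_[p] ℚ_[p]) (p := g.charpoly) (ε : ℤ_[p])
    simpa using this
  have hεu : IsUnit ((ε : ℤ_[p]) ^ n) := (IsUnit.of_mul_eq_one _ hεp).pow n
  have hdet : (1 - (ε : ℤ_[p]) • g).det ≠ 0 := by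
    intro h0
    rw [h0, mul_zero, PadicInt.coe_zero] at heval
    exact hne (by exact_mod_cast heval)
  have hvalP : padicValRat p (P.eval (ε : ℚ)) = ((1 - (ε : ℤ_[p]) • g).det.valuation : ℤ) := by
    rw [← Padic.valuation_ratCast, heval, PadicInt.valuation_coe,
      PadicInt.valuation_eq_of_associated (associated_unit_mul_left _ _ hεu)]
  rw [padicValRat.mul hne (Int.cast_ne_zero.2 hG0), hvalP, ← hval, ← Nat.cast_add,
    Int.even_coe_nat]
  exact even_valuation_det_one_sub_add hG0p hdvd hiso hdet

theorem exists_int_sq_of_isSquare_mul {c : ℤ} {r w : ℚ} (hw : w ≠ 0)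
    (hr : IsSquare |r|) (h : |r| = w ^ 2 * |(c : ℚ)|) : ∃ k : ℤ, |(c : ℚ)| = (k : ℚ) ^ 2 := by
  obtain ⟨s, hs⟩ := hr
  have h1 : IsSquare (((|c| : ℤ)) : ℚ) := by
    refine ⟨s / w, ?_⟩
    rw [Int.cast_abs, div_mul_div_comm, ← hs, h]
    field_simp
  obtain ⟨k, hk⟩ := Rat.isSquare_intCast_iff.1 h1
  exact ⟨k, by rw [← Int.cast_abs, hk, Int.cast_mul, sq]⟩

end Parity

/-! ### Conclusion -/

theorem mainTheorem11 (V : Type*) [AddCommGroup V] [Module.Free ℤ V] [Module.Finite ℤ V]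
    (q : QuadraticForm ℤ V) (hq : QuadZ.IsRegular q)
    (a b : ℕ) (P Q : ℚ[X])
    (hmonic : P.Monic) (hdeg : P.natDegree = Module.finrank ℤ V)
    (hP : P = (X - 1) ^ a * (X + 1) ^ (2 * b) * Q)
    (hQ : Q.eval 1 * Q.eval (-1) ≠ 0)
    (hγ : ∀ (p : ℕ) [Fact p.Prime], ∃ γ ∈ QuadZ.SO (QuadZ.baseChange ℤ_[p] q),
      (LinearMap.charpoly (γ : ℤ_[p] ⊗[ℤ] V →ₗ[ℤ_[p]] ℤ_[p] ⊗[ℤ] V)).map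
        (algebraMap ℤ_[p] ℚ_[p]) = P.map (algebraMap ℚ ℚ_[p])) :
    (b = 0 → ∃ k : ℤ, |Q.eval (-1)| = (k : ℚ) ^ 2) ∧
      (a = 0 → ∃ k : ℤ, |Q.eval 1| = (k : ℚ) ^ 2) := by
  obtain ⟨n, e, hdet⟩ := hq.exists_basis
  obtain ⟨T, hT, hSO⟩ := QuadZ.exists_matrix_of_mem_SO q e
  rw [hT] at hdet
  have hdvd : (T + T.transpose).det.natAbs ∣ 2 := by
    rcases hdet with h | ⟨-, h⟩ <;> rw [h]; norm_num
  have hdet0 : (T + T.transpose).det ≠ 0 := by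
    rintro h0
    rw [h0] at hdvd
    simp at hdvd
  have hQ1 : Q.eval 1 ≠ 0 := left_ne_zero_of_mul hQ
  have hQ2 : Q.eval (-1) ≠ 0 := right_ne_zero_of_mul hQ
  have hsq : ∀ ε : ℤ, ε * ε = 1 → P.eval (ε : ℚ) ≠ 0 →
      IsSquare |P.eval (ε : ℚ) * (T + T.transpose).det| := by
    intro ε hε hne
    refine Rat.isSquare_abs_of_forall_even_padicValRat
      (mul_ne_zero hne (Int.cast_ne_zero.2 hdet0)) fun p hp => ?_
    have := Fact.mk hp
    obtain ⟨γ, hγ1, hγ2⟩ := hγ p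
    obtain ⟨g, hg1, -, hg3⟩ := hSO ℤ_[p] γ hγ1
    exact even_padicValRat_eval_mul_det hdvd hg1 (by rw [hg3, hγ2]) hε hne
  obtain ⟨P₀, hP₀⟩ := mem_lifts_int_of_forall_padic (P := P) fun p _ => by
    obtain ⟨γ, -, hγ2⟩ := hγ p
    exact ⟨_, hγ2⟩
  obtain ⟨Q₀, hQ₀⟩ := exists_int_factor (P₀ := P₀) (F := (X - 1) ^ a * (X + 1) ^ (2 * b)) (Q := Q)
    (((monic_X_sub_C (1 : ℤ)).pow a).mul ((monic_X_add_C (1 : ℤ)).pow (2 * b)))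
    (by rw [hP₀, hP]; simp)
  have hQeval : ∀ ε : ℤ, Q.eval (ε : ℚ) = ((Q₀.eval ε : ℤ) : ℚ) := by
    intro ε
    rw [← hQ₀]
    exact eval_map_apply (f := Int.castRingHom ℚ) (p := Q₀) ε
  have hparity : Even a ↔ Even n := by
    refine even_iff_of_reverse_eq hP hQ1 ?_
    -- Any single prime would do: the functional equation descends from `ℚ_p` to `ℚ`.
    obtain ⟨γ, hγ1, hγ2⟩ := hγ 2
    obtain ⟨g, hg1, hg2, hg3⟩ := hSO ℤ_[2] γ hγ1
    let φ := algebraMap ℤ_[2] ℚ_[2]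
    have hφ : Function.Injective φ := IsFractionRing.injective ℤ_[2] ℚ_[2]
    set S := T.map (Int.cast : ℤ → ℤ_[2]) + (T.map (Int.cast : ℤ → ℤ_[2])).transpose with hS
    have hS0 : S.det ≠ 0 := by
      have : S = (Int.castRingHom ℤ_[2]).mapMatrix (T + T.transpose) := by
        ext i j
        simp [hS]
      rw [this, ← RingHom.map_det]
      exact Int.cast_ne_zero.2 hdet0
    have h1 := Matrix.reverse_charpoly_of_isometry (G := φ.mapMatrix S) (g := φ.mapMatrix g)
      (by rw [← RingHom.map_det]; exact (map_ne_zero_iff φ hφ).2 hS0)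
      (by
        conv_rhs => rw [← hg1]
        rw [map_mul, map_mul]
        rfl)
      (by rw [← RingHom.map_det, hg2, map_one])
    rw [RingHom.mapMatrix_apply, Matrix.charpoly_map, hg3, hγ2, Fintype.card_fin,
      reverse_map_of_injective _ (algebraMap ℚ ℚ_[2]).injective] at h1
    apply map_injective _ (algebraMap ℚ ℚ_[2]).injective
    rw [h1]
    simp
  have hdetEven : (T + T.transpose).det.natAbs = 1 → Even n := by
    intro h
    have := even_card_of_odd_det_add_transpose T (Int.natAbs_odd.1 (h ▸ odd_one))
    rwa [Fintype.card_fin] at this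
  have habs : |((T + T.transpose).det : ℚ)| = ((T + T.transpose).det.natAbs : ℚ) := by
    rw [Nat.cast_natAbs, Int.cast_abs]
  constructor
  · rintro rfl
    have hPeval : P.eval ((-1 : ℤ) : ℚ) = (-2) ^ a * Q.eval (-1) := by
      rw [hP]
      simp
      norm_num
    have h1 := hsq (-1) (by norm_num) (by
      rw [hPeval]
      exact mul_ne_zero (pow_ne_zero _ (by norm_num)) hQ2)
    have hQe := hQeval (-1)
    push_cast at hQe
    -- Either `a` is even and `|det G| = 1`, or `a` is odd and `|det G| = 2` supplies the missing
    -- factor 2.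
    obtain ⟨j, hj⟩ : ∃ j : ℕ, (2 : ℚ) ^ a * (T + T.transpose).det.natAbs = (2 ^ j) ^ 2 := by
      rcases hdet with h | ⟨hn, h⟩
      · obtain ⟨j, hj⟩ := hparity.2 (hdetEven h)
        exact ⟨j, by rw [h, hj]; push_cast; ring⟩
      · obtain ⟨j, hj⟩ := Nat.not_even_iff_odd.1
          (fun ha => Nat.not_even_iff_odd.2 hn (hparity.1 ha))
        exact ⟨j + 1, by rw [h, hj]; push_cast; ring⟩
    rw [hQe]
    refine exists_int_sq_of_isSquare_mul (w := 2 ^ j) (by positivity) h1 ?_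
    rw [hPeval, hQe, abs_mul, abs_mul, abs_pow, habs, ← hj]
    norm_num
    ring
  · rintro rfl
    have hPeval : P.eval ((1 : ℤ) : ℚ) = (2 ^ b) ^ 2 * Q.eval 1 := by
      rw [hP]
      simp
      norm_num [pow_mul, mul_comm]
    have h1 := hsq 1 (by norm_num) (by
      rw [hPeval]
      exact mul_ne_zero (pow_ne_zero _ (by positivity)) hQ1)
    have hQe := hQeval 1
    push_cast at hQe
    have hdet1 : (T + T.transpose).det.natAbs = 1 := by
      rcases hdet with h | ⟨hn, -⟩
      · exact h
      · exact absurd (hparity.1 Even.zero) (Nat.not_even_iff_odd.2 hn)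
    rw [hQe]
    refine exists_int_sq_of_isSquare_mul (w := 2 ^ b) (by positivity) h1 ?_
    rw [hPeval, hQe, abs_mul, abs_mul, habs, hdet1]
    simp
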